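/- **Theorem 7.2.** Let $0<q<1$, and for complex $\alpha$ put $(\alpha;q)_n=\prod_{j=0}^{n-1}(1-\alpha q^j)$, $(\alpha;q)_\infty=\prod_{j=0}^{\infty}(1-\alpha q^j)$, and $(\alpha_1,\dots,\alpha_m;q)_n=(\alpha_1;q)_n\cdots(\alpha_m;q)_n$ for $n$ a nonnegative integer or $\infty$. Let ${k\brack r}_q=\frac{(q;q)_k}{(q;q)_r(q;q)_{k-r}}$ for $0\le r\le k$, and let the Jackson $q$-integral be $$\int_u^v f(x)\,d_qx=(1-q)\sum_{n=0}^\infty\bigl[v f(vq^n)-u f(uq^n)\bigr]q^n .$$ For $k\ge 0$ define $$H_k(a,b,u,v)=\sum_{r=0}^k {k\brack r}_q\frac{(au,av;q)_r}{(abuv;q)_r}\,b^r a^{k-r}.$$ Let $a,b,c,d,u,v$ be complex numbers with $u\neq 0$, $v\neq 0$ and $$\max\{|au|,|bu|,|cu|,|du|,|av|,|bv|,|cv|,|dv|\}<1 .$$ (Under this condition the denominators in the integral and in $H_k$ have no zero factors.) Then the series defining the integral below and the series on the right-hand side converge absolutely, and $$\int_u^v\frac{(qx/u,qx/v;q)_\infty}{(ax,bx,cx,dx;q)_\infty}\,d_qx=\frac{(1-q)\,v\,(q,u/v,qv/u,abuv,cduv;q)_\infty}{(au,bu,cu,du,av,bv,cv,dv;q)_\infty}\sum_{k=0}^\infty\frac{q^{k(k-1)/2}(-uv)^k}{(q;q)_k}\,H_k(a,b,u,v)\,H_k(c,d,u,v).$$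 -/

import Mathlib

open Finset

noncomputable section

/-- The finite `q`-shifted factorial `(a; q)_n = ∏_{k=0}^{n-1} (1 - a q^k)`. -/
def qPoch (a q : ℂ) (n : ℕ) : ℂ :=
  ∏ k ∈ range n, (1 - a * q ^ k)

/-- The infinite `q`-shifted factorial `(a; q)_∞ = ∏_{k=0}^∞ (1 - a q^k)`
(the product converges for every `a` when `|q| < 1`). -/
def qPochInf (a q : ℂ) : ℂ :=
  ∏' k : ℕ, (1 - a * q ^ k)

/-- The Gaussian binomial coefficient `(q; q)_n / ((q; q)_k (q; q)_{n-k})`, used for `k ≤ n`. -/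
def qBinom (q : ℂ) (n k : ℕ) : ℂ :=
  qPoch q q n / (qPoch q q k * qPoch q q (n - k))

/-- The `n`-th term `[v f(v q^n) - u f(u q^n)] q^n` of the series defining the
Jackson `q`-integral of `f` from `u` to `v`. -/
def jacksonTerm (q u v : ℂ) (f : ℂ → ℂ) (n : ℕ) : ℂ :=
  (v * f (v * q ^ n) - u * f (u * q ^ n)) * q ^ n

/-- The Jackson `q`-integral
`∫_u^v f(x) d_q x = (1 - q) ∑_{n=0}^∞ [v f(v q^n) - u f(u q^n)] q^n`. -/
def jacksonIntegral (q u v : ℂ) (f : ℂ → ℂ) : ℂ :=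
  (1 - q) * ∑' n : ℕ, jacksonTerm q u v f n

/-- `H_k(a, b, u, v) = ∑_{r=0}^k [k choose r]_q (au, av; q)_r / (abuv; q)_r * b^r a^{k-r}`. -/
def andrewsAskeyH (q : ℂ) (k : ℕ) (a b u v : ℂ) : ℂ :=
  ∑ r ∈ range (k + 1),
    qBinom q k r * (qPoch (a * u) q r * qPoch (a * v) q r / qPoch (a * b * u * v) q r)
      * b ^ r * a ^ (k - r)

/-- The integrand `(qx/u, qx/v; q)_∞ / (ax, bx, cx, dx; q)_∞`. -/
def andrewsAskeyIntegrand (q a b c d u v x : ℂ) : ℂ :=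
  (qPochInf (q * x / u) q * qPochInf (q * x / v) q) /
    (qPochInf (a * x) q * qPochInf (b * x) q * qPochInf (c * x) q * qPochInf (d * x) q)

/-- The `k`-th term `q^{k(k-1)/2} (-uv)^k / (q; q)_k * H_k(a, b, u, v) H_k(c, d, u, v)`. -/
def andrewsAskeyTerm (q a b c d u v : ℂ) (k : ℕ) : ℂ :=
  q ^ (k * (k - 1) / 2) * (-(u * v)) ^ k / qPoch q q k
    * andrewsAskeyH q k a b u v * andrewsAskeyH q k c d u v

end

/-!
# An extension of the Andrews–Askey `q`-integral

Write `R_n(a, b) = ∑_{i+j=n} (q; q)_n / ((q; q)_i (q; q)_j) a^i b^j` for the Rogers–Szegő polynomials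
and `w(x) = (qx/u, qx/v; q)_∞` for the weight in the integrand. The identity is a Parseval formula
that rests on three facts.

* By `q`-integration by parts, the moments of `w` satisfy the three-term recurrence of
  `R_n(u, v)`, so the `n`-th moment is the total mass times `R_n(u, v)` (`weightMoment_eq`). The
  total mass is found without Jacobi's triple product: if `‖u‖ ≤ ‖v‖`, integrating the expansion of
  `1 / (qx/v; q)_∞` against `w` gives a telescoping series, and the general case follows by
  antisymmetry in `u` and `v` (`weightMoment_zero`).
* The linearization formula (`rogersSzego_add_div`)
  `R_{n+m} / ((q; q)_n (q; q)_m) = ∑_k q^{k(k-1)/2} (-uv)^k / (q; q)_k *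
  (R_{n-k} / (q; q)_{n-k}) (R_{m-k} / (q; q)_{m-k})`, all polynomials being taken at `(u, v)`.
* The shifted `q`-Mehler formula (`shiftedPairing_rogersSzego`)
  `∑_n R_{n+k}(a, b) R_n(u, v) / (q; q)_n =
  (abuv; q)_∞ / (au, av, bu, bv; q)_∞ * H_k(a, b, u, v)`. Here `H_k` appears because
  `R_{n+k}(a, b) = ∑_r [k choose r]_q b^r a^{k-r} R_n(a q^r, b)` (`rogersSzego_add`), which reduces
  the formula to `k = 0`; the case `k = 0` again comes from the linearization formula.

Since `1 / (ax, bx; q)_∞ = ∑_n R_n(a, b) x^n / (q; q)_n`, integrating term by term turns the integral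
into the double sum of `R_n(a, b) R_m(c, d) R_{n+m}(u, v) / ((q; q)_n (q; q)_m)`. Linearization
splits it into a single sum over `k` of products of two shifted Mehler sums
(`hasSum_mul_rogersSzego_add`), which is the right-hand side. All rearrangements are justified by
the bound `‖R_n(a, b)‖ ≤ C (n + 1) max(‖a‖, ‖b‖)^n` together with
`max(‖a‖, ‖b‖) max(‖u‖, ‖v‖) < 1`.
-/

open Filter Topology

/-! ### Infinite `q`-shifted factorials and Euler's expansions -/

section Pochhammer

variable {q : ℂ}

lemma qPoch_zero (a q : ℂ) : qPoch a q 0 = 1 := by simp [qPoch]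

lemma qPoch_succ (a q : ℂ) (n : ℕ) : qPoch a q (n + 1) = qPoch a q n * (1 - a * q ^ n) := by
  simp [qPoch, prod_range_succ]

lemma qPoch_self_succ (q : ℂ) (n : ℕ) :
    qPoch q q (n + 1) = qPoch q q n * (1 - q ^ (n + 1)) := by
  rw [qPoch_succ, pow_succ']

lemma one_sub_mul_pow_ne_zero (hq : ‖q‖ < 1) {z : ℂ} (hz : ‖z‖ < 1) (n : ℕ) :
    1 - z * q ^ n ≠ 0 := by
  intro h
  have h1 : ‖z * q ^ n‖ = 1 := by rw [← sub_eq_zero.mp h]; simp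
  rw [norm_mul, norm_pow] at h1
  have h2 : ‖q‖ ^ n ≤ 1 := pow_le_one₀ (norm_nonneg _) hq.le
  nlinarith [norm_nonneg z, norm_nonneg q]

lemma one_sub_pow_succ_ne_zero (hq : ‖q‖ < 1) (n : ℕ) : 1 - q ^ (n + 1) ≠ 0 := by
  rw [pow_succ']
  exact one_sub_mul_pow_ne_zero hq hq n

lemma qPoch_ne_zero (hq : ‖q‖ < 1) {z : ℂ} (hz : ‖z‖ < 1) (n : ℕ) : qPoch z q n ≠ 0 :=
  prod_ne_zero_iff.mpr fun k _ => one_sub_mul_pow_ne_zero hq hz k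

lemma summable_norm_mul_pow (hq : ‖q‖ < 1) (z : ℂ) : Summable fun k : ℕ => ‖-(z * q ^ k)‖ := by
  simp only [norm_neg, norm_mul, norm_pow]
  exact (summable_geometric_of_lt_one (norm_nonneg _) hq).mul_left _

lemma multipliable_one_sub_mul_pow (hq : ‖q‖ < 1) (z : ℂ) :
    Multipliable fun k : ℕ => 1 - z * q ^ k := by
  simpa only [sub_eq_add_neg] using multipliable_one_add_of_summable (summable_norm_mul_pow hq z)

lemma tendsto_qPoch (hq : ‖q‖ < 1) (z : ℂ) :
    Tendsto (qPoch z q) atTop (𝓝 (qPochInf z q)) :=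
  (multipliable_one_sub_mul_pow hq z).hasProd.tendsto_prod_nat

lemma qPochInf_ne_zero (hq : ‖q‖ < 1) {z : ℂ} (hz : ‖z‖ < 1) : qPochInf z q ≠ 0 := by
  have := tprod_one_add_ne_zero_of_summable (f := fun k : ℕ => -(z * q ^ k))
    (fun k => by simpa only [← sub_eq_add_neg] using one_sub_mul_pow_ne_zero hq hz k)
    (summable_norm_mul_pow hq z)
  simpa only [qPochInf, ← sub_eq_add_neg] using this

lemma qPoch_mul_qPochInf (hq : ‖q‖ < 1) (z : ℂ) (n : ℕ) :
    qPoch z q n * qPochInf (z * q ^ n) q = qPochInf z q := by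
  have h : Tendsto (fun m => qPoch z q (m + n)) atTop (𝓝 (qPochInf z q)) :=
    (tendsto_add_atTop_iff_nat n).mpr (tendsto_qPoch hq z)
  refine tendsto_nhds_unique (((tendsto_qPoch hq (z * q ^ n)).const_mul (qPoch z q n))) ?_
  convert h using 2 with m
  rw [add_comm, qPoch, qPoch, qPoch, prod_range_add]
  congr 1
  exact prod_congr rfl fun k _ => by ring

lemma qPochInf_eq_one_sub_mul (hq : ‖q‖ < 1) (z : ℂ) :
    qPochInf z q = (1 - z) * qPochInf (z * q) q := by
  simpa [qPoch] using (qPoch_mul_qPochInf hq z 1).symm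

lemma tendsto_mul_pow_zero (hq : ‖q‖ < 1) (z : ℂ) :
    Tendsto (fun n : ℕ => z * q ^ n) atTop (𝓝 0) := by
  simpa using (tendsto_pow_atTop_nhds_zero_of_norm_lt_one hq).const_mul z

lemma tendsto_qPochInf_mul_pow (hq : ‖q‖ < 1) (z : ℂ) :
    Tendsto (fun n => qPochInf (z * q ^ n) q) atTop (𝓝 1) := by
  have key : ∀ w : ℂ, ‖w‖ < 1 → Tendsto (fun n => qPochInf (w * q ^ n) q) atTop (𝓝 1) := by
    intro w hw
    have h := ((tendsto_qPoch hq w).inv₀ (qPochInf_ne_zero hq hw)).mul_const (qPochInf w q)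
    rw [inv_mul_cancel₀ (qPochInf_ne_zero hq hw)] at h
    refine h.congr fun n => ?_
    rw [← qPoch_mul_qPochInf hq w n, inv_mul_cancel_left₀ (qPoch_ne_zero hq hw n)]
  obtain ⟨N, hN⟩ : ∃ N : ℕ, ‖z * q ^ N‖ < 1 :=
    (((tendsto_mul_pow_zero hq z).norm).eventually_lt_const (by simp)).exists
  rw [← tendsto_add_atTop_iff_nat N]
  refine (key _ hN).congr fun n => ?_
  rw [pow_add]
  ring_nf

lemma exists_norm_qPoch_le (hq : ‖q‖ < 1) :
    ∃ C : ℝ, 1 ≤ C ∧ ∀ n, ‖qPoch q q n‖ ≤ C ∧ ‖(qPoch q q n)⁻¹‖ ≤ C := by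
  have h1 := Metric.isBounded_range_of_tendsto _ (tendsto_qPoch hq q)
  have h2 := Metric.isBounded_range_of_tendsto _
    ((tendsto_qPoch hq q).inv₀ (qPochInf_ne_zero hq hq))
  obtain ⟨A, hA⟩ := h1.exists_norm_le
  obtain ⟨B, hB⟩ := h2.exists_norm_le
  refine ⟨max 1 (max A B), le_max_left _ _, fun n => ⟨?_, ?_⟩⟩
  · exact (hA _ ⟨n, rfl⟩).trans ((le_max_left _ _).trans (le_max_right _ _))
  · exact (hB _ ⟨n, rfl⟩).trans ((le_max_right _ _).trans (le_max_right _ _))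

/-- A power series with bounded coefficients is summable inside the unit disc. -/
lemma summable_norm_mul_pow_of_bounded {c : ℕ → ℂ} {C : ℝ} (hc : ∀ n, ‖c n‖ ≤ C) {z : ℂ}
    (hz : ‖z‖ < 1) : Summable fun n => ‖c n * z ^ n‖ := by
  refine Summable.of_nonneg_of_le (fun _ => norm_nonneg _) (fun n => ?_)
    ((summable_geometric_of_lt_one (norm_nonneg z) hz).mul_left C)
  rw [norm_mul, norm_pow]
  gcongr
  exact hc n

/-- A power series with bounded coefficients tends to its constant term along `z q ^ n`. -/
lemma tendsto_tsum_mul_pow {c : ℕ → ℂ} {C : ℝ} (hc : ∀ n, ‖c n‖ ≤ C) (hq : ‖q‖ < 1) {z : ℂ}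
    (hz : ‖z‖ < 1) :
    Tendsto (fun k : ℕ => ∑' n, c n * (z * q ^ k) ^ n) atTop (𝓝 (c 0)) := by
  have h0 : (∑' n, if n = 0 then c 0 else 0) = c 0 := tsum_ite_eq 0 _
  rw [← h0]
  refine tendsto_tsum_of_dominated_convergence
    ((summable_geometric_of_lt_one (norm_nonneg z) hz).mul_left C) (fun n => ?_) ?_
  · rcases n with _ | n
    · simp
    · simpa using ((tendsto_mul_pow_zero hq z).pow (n + 1)).const_mul (c (n + 1))
  · refine Eventually.of_forall fun k n => ?_
    rw [norm_mul, norm_pow, norm_mul, norm_pow]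
    have : ‖z‖ * ‖q‖ ^ k ≤ ‖z‖ :=
      mul_le_of_le_one_right (norm_nonneg _) (pow_le_one₀ (norm_nonneg _) hq.le)
    exact mul_le_mul (hc n) (pow_le_pow_left₀ (by positivity) this n) (by positivity)
      ((norm_nonneg _).trans (hc n))

lemma norm_mul_lt_one {a b : ℂ} (ha : ‖a‖ < 1) (hb : ‖b‖ < 1) : ‖a * b‖ < 1 := by
  rw [norm_mul]
  exact mul_lt_one_of_nonneg_of_lt_one_left (norm_nonneg _) ha hb.le

lemma norm_mul_pow_lt_one (hq : ‖q‖ < 1) {z : ℂ} (hz : ‖z‖ < 1) (n : ℕ) : ‖z * q ^ n‖ < 1 := by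
  rw [norm_mul, norm_pow]
  exact (mul_le_of_le_one_right (norm_nonneg _) (pow_le_one₀ (norm_nonneg _) hq.le)).trans_lt hz

lemma summable_norm_pow_div_qPoch (hq : ‖q‖ < 1) {z : ℂ} (hz : ‖z‖ < 1) :
    Summable fun n => ‖(qPoch q q n)⁻¹ * z ^ n‖ := by
  obtain ⟨C, -, hC⟩ := exists_norm_qPoch_le hq
  exact summable_norm_mul_pow_of_bounded (fun n => (hC n).2) hz

/-- Euler's expansion `∑ z ^ n / (q; q)_n = 1 / (z; q)_∞`. The sum `f` satisfies
`(1 - z) f(z) = f(z q)`. -/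
lemma tsum_pow_div_qPoch (hq : ‖q‖ < 1) {z : ℂ} (hz : ‖z‖ < 1) :
    ∑' n, (qPoch q q n)⁻¹ * z ^ n = (qPochInf z q)⁻¹ := by
  obtain ⟨C, -, hC⟩ := exists_norm_qPoch_le hq
  set f : ℂ → ℂ := fun z => ∑' n, (qPoch q q n)⁻¹ * z ^ n with hf
  have step : ∀ w : ℂ, ‖w‖ < 1 → (1 - w) * f w = f (w * q) := by
    intro w hw
    have hs := (summable_norm_pow_div_qPoch hq hw).of_norm
    have hs' := (summable_norm_pow_div_qPoch hq (norm_mul_lt_one hw hq)).of_norm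
    have h1 : f w - f (w * q) = w * f w := by
      simp only [hf]
      rw [← hs.tsum_sub hs', (hs.sub hs').tsum_eq_zero_add, ← tsum_mul_left]
      simp only [pow_zero, sub_self, zero_add]
      refine tsum_congr fun n => ?_
      have := one_sub_pow_succ_ne_zero hq n
      have := qPoch_ne_zero hq hq n
      rw [qPoch_self_succ, mul_pow]
      field_simp
      ring
    linear_combination h1
  have iter : ∀ n, qPoch z q n * f z = f (z * q ^ n) := by
    intro n
    induction n with
    | zero => simp [qPoch_zero]
    | succ n ih =>
      rw [qPoch_succ, pow_succ, ← mul_assoc, ← step _ (norm_mul_pow_lt_one hq hz n), ← ih]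
      ring
  have h1 : Tendsto (fun n => f (z * q ^ n)) atTop (𝓝 1) := by
    simpa [qPoch_zero] using tendsto_tsum_mul_pow (fun n => (hC n).2) hq hz
  have h2 := (tendsto_qPoch hq z).mul_const (f z)
  simp only [iter] at h2
  exact eq_inv_of_mul_eq_one_right (tendsto_nhds_unique h2 h1)

/-- The coefficient `q^{k(k-1)/2} (-y)^k / (q; q)_k` of Euler's expansion of `(y; q)_∞`. -/
noncomputable def eulerCoeff (q y : ℂ) (k : ℕ) : ℂ := q ^ (k * (k - 1) / 2) * (-y) ^ k / qPoch q q k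

lemma eulerCoeff_zero (q y : ℂ) : eulerCoeff q y 0 = 1 := by simp [eulerCoeff, qPoch_zero]

lemma eulerCoeff_succ (hq : ‖q‖ < 1) (y : ℂ) (k : ℕ) :
    (1 - q ^ (k + 1)) * eulerCoeff q y (k + 1) = -y * q ^ k * eulerCoeff q y k := by
  have h1 := one_sub_pow_succ_ne_zero hq k
  have h2 := qPoch_ne_zero hq hq k
  rw [eulerCoeff, eulerCoeff, qPoch_self_succ, Nat.triangle_succ, pow_add q _ k]
  generalize 1 - q ^ (k + 1) = Q at h1 ⊢
  field_simp
  ring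

lemma eulerCoeff_mul_pow (q y z : ℂ) (k : ℕ) :
    eulerCoeff q y k * z ^ k = eulerCoeff q (y * z) k := by
  rw [eulerCoeff, eulerCoeff, ← neg_mul, mul_pow]
  ring

lemma exists_norm_eulerCoeff_le (hq : ‖q‖ < 1) :
    ∃ C : ℝ, 1 ≤ C ∧ ∀ y k, ‖eulerCoeff q y k‖ ≤ C * ‖y‖ ^ k := by
  obtain ⟨C, h1, hC⟩ := exists_norm_qPoch_le hq
  refine ⟨C, h1, fun y k => ?_⟩
  rw [eulerCoeff, div_eq_mul_inv, norm_mul, norm_mul, norm_pow, norm_pow, norm_neg, mul_comm]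
  have := (hC k).2
  have h2 : ‖q‖ ^ (k * (k - 1) / 2) * ‖y‖ ^ k ≤ ‖y‖ ^ k :=
    mul_le_of_le_one_left (by positivity) (pow_le_one₀ (norm_nonneg _) hq.le)
  gcongr

/-- Euler's expansion of `(z; q)_∞`; only `‖z‖ < 1` is needed here. The sum `f` satisfies
`f(z) = (1 - z) f(z q)`. -/
lemma tsum_eulerCoeff (hq : ‖q‖ < 1) {z : ℂ} (hz : ‖z‖ < 1) :
    ∑' n, eulerCoeff q z n = qPochInf z q := by
  obtain ⟨C, -, hC⟩ := exists_norm_eulerCoeff_le hq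
  have hC1 : ∀ n, ‖eulerCoeff q 1 n‖ ≤ C := fun n => by simpa using hC 1 n
  have hcoe : ∀ w n, eulerCoeff q w n = eulerCoeff q 1 n * w ^ n := fun w n => by
    rw [eulerCoeff_mul_pow, one_mul]
  set f : ℂ → ℂ := fun z => ∑' n, eulerCoeff q z n with hf
  have hsum : ∀ w : ℂ, ‖w‖ < 1 → Summable (eulerCoeff q w) := fun w hw => by
    simp only [funext (hcoe w)]
    exact (summable_norm_mul_pow_of_bounded hC1 hw).of_norm
  have step : ∀ w : ℂ, ‖w‖ < 1 → f w = (1 - w) * f (w * q) := by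
    intro w hw
    have hs := hsum w hw
    have hs' := hsum _ (norm_mul_lt_one hw hq)
    have h1 : f w - f (w * q) = -w * f (w * q) := by
      simp only [hf]
      rw [← hs.tsum_sub hs', (hs.sub hs').tsum_eq_zero_add, ← tsum_mul_left]
      simp only [eulerCoeff_zero, sub_self, zero_add]
      refine tsum_congr fun n => ?_
      rw [← eulerCoeff_mul_pow q w q, ← eulerCoeff_mul_pow q w q]
      linear_combination eulerCoeff_succ hq w n
    linear_combination h1
  have iter : ∀ n, f z = qPoch z q n * f (z * q ^ n) := by
    intro n
    induction n with
    | zero => simp [qPoch_zero]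
    | succ n ih =>
      rw [qPoch_succ, pow_succ, ← mul_assoc, ih, step _ (norm_mul_pow_lt_one hq hz n)]
      ring
  have h1 : Tendsto (fun n => f (z * q ^ n)) atTop (𝓝 1) := by
    have h := tendsto_tsum_mul_pow hC1 hq hz
    rw [eulerCoeff_zero] at h
    exact h.congr fun n => tsum_congr fun k => (hcoe _ _).symm
  have h2 := (tendsto_qPoch hq z).mul h1
  simp only [← iter, mul_one] at h2
  exact tendsto_nhds_unique tendsto_const_nhds h2

end Pochhammer

/-! ### Rogers–Szegő polynomials -/

section RogersSzego

variable {q : ℂ}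

/-- The Rogers–Szegő polynomial divided by `(q; q)_n`, in homogeneous form:
`∑_{i+j=n} a^i b^j / ((q; q)_i (q; q)_j)`. It is the coefficient of `x ^ n` in
`1 / (ax, bx; q)_∞`. -/
noncomputable def rogersSzegoDiv (q : ℂ) (n : ℕ) (a b : ℂ) : ℂ :=
  ∑ p ∈ antidiagonal n, ((qPoch q q p.1)⁻¹ * a ^ p.1) * ((qPoch q q p.2)⁻¹ * b ^ p.2)

/-- The homogeneous Rogers–Szegő polynomial `∑_{i+j=n} (q; q)_n / ((q; q)_i (q; q)_j) a^i b^j`. -/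
noncomputable def rogersSzego (q : ℂ) (n : ℕ) (a b : ℂ) : ℂ := qPoch q q n * rogersSzegoDiv q n a b

lemma rogersSzegoDiv_zero (q a b : ℂ) : rogersSzegoDiv q 0 a b = 1 := by
  simp [rogersSzegoDiv, qPoch_zero]

lemma rogersSzego_zero (q a b : ℂ) : rogersSzego q 0 a b = 1 := by
  simp [rogersSzego, rogersSzegoDiv_zero, qPoch_zero]

lemma rogersSzegoDiv_sub_mul_left (hq : ‖q‖ < 1) (n : ℕ) (a b : ℂ) :
    rogersSzegoDiv q (n + 1) a b - rogersSzegoDiv q (n + 1) (a * q) b =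
      a * rogersSzegoDiv q n a b := by
  simp only [rogersSzegoDiv]
  rw [← sum_sub_distrib, Nat.sum_antidiagonal_succ, mul_sum]
  simp only [pow_zero, sub_self, zero_add]
  refine sum_congr rfl fun p _ => ?_
  have := one_sub_pow_succ_ne_zero hq p.1
  have := qPoch_ne_zero hq hq p.1
  have := qPoch_ne_zero hq hq p.2
  rw [qPoch_self_succ, mul_pow]
  field_simp
  ring

lemma rogersSzegoDiv_succ (hq : ‖q‖ < 1) (n : ℕ) (a b : ℂ) :
    (1 - q ^ (n + 1)) * rogersSzegoDiv q (n + 1) a b =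
      a * rogersSzegoDiv q n a b + b * rogersSzegoDiv q n (a * q) b := by
  -- split `1 - q ^ (i + j) = (1 - q ^ i) + q ^ i (1 - q ^ j)`
  have h2 : rogersSzegoDiv q (n + 1) (a * q) b - q ^ (n + 1) * rogersSzegoDiv q (n + 1) a b =
      b * rogersSzegoDiv q n (a * q) b := by
    simp only [rogersSzegoDiv]
    rw [mul_sum, ← sum_sub_distrib, Nat.sum_antidiagonal_succ', mul_sum]
    have h0 : (a * q) ^ (n + 1) = q ^ (n + 1) * a ^ (n + 1) := by rw [mul_pow, mul_comm]
    rw [h0]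
    have h1 : ∀ x y z : ℂ, x * (q ^ (n + 1) * y) * z - q ^ (n + 1) * (x * y * z) = 0 := by
      intros; ring
    rw [h1, zero_add]
    refine sum_congr rfl fun p hp => ?_
    rw [HasAntidiagonal.mem_antidiagonal] at hp
    have := one_sub_pow_succ_ne_zero hq p.2
    have := qPoch_ne_zero hq hq p.1
    have := qPoch_ne_zero hq hq p.2
    rw [qPoch_self_succ, mul_pow, ← hp, add_assoc, pow_add q p.1 (p.2 + 1)]
    field_simp
    ring
  linear_combination rogersSzegoDiv_sub_mul_left hq n a b + h2

lemma rogersSzego_succ (hq : ‖q‖ < 1) (n : ℕ) (a b : ℂ) :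
    rogersSzego q (n + 1) a b = a * rogersSzego q n a b + b * rogersSzego q n (a * q) b := by
  simp only [rogersSzego, qPoch_self_succ]
  linear_combination qPoch q q n * rogersSzegoDiv_succ hq n a b

lemma rogersSzegoDiv_one (hq : ‖q‖ < 1) (a b : ℂ) :
    (1 - q) * rogersSzegoDiv q 1 a b = a + b := by
  simpa [rogersSzegoDiv_zero] using rogersSzegoDiv_succ hq 0 a b

lemma rogersSzegoDiv_add_two (hq : ‖q‖ < 1) (n : ℕ) (a b : ℂ) :
    (1 - q ^ (n + 2)) * rogersSzegoDiv q (n + 2) a b =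
      (a + b) * rogersSzegoDiv q (n + 1) a b - a * b * rogersSzegoDiv q n a b := by
  linear_combination rogersSzegoDiv_succ hq (n + 1) a b -
    b * rogersSzegoDiv_sub_mul_left hq n a b

lemma rogersSzego_one (hq : ‖q‖ < 1) (a b : ℂ) : rogersSzego q 1 a b = a + b := by
  rw [← rogersSzegoDiv_one hq, rogersSzego]
  simp [qPoch]

lemma rogersSzego_add_two (hq : ‖q‖ < 1) (n : ℕ) (a b : ℂ) :
    rogersSzego q (n + 2) a b =
      (a + b) * rogersSzego q (n + 1) a b - a * b * (1 - q ^ (n + 1)) * rogersSzego q n a b := by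
  simp only [rogersSzego, qPoch_self_succ]
  linear_combination qPoch q q n * (1 - q ^ (n + 1)) * rogersSzegoDiv_add_two hq n a b

lemma qBinom_zero_right (hq : ‖q‖ < 1) (k : ℕ) : qBinom q k 0 = 1 := by
  simp [qBinom, qPoch_zero, qPoch_ne_zero hq hq]

lemma qBinom_self (hq : ‖q‖ < 1) (k : ℕ) : qBinom q k k = 1 := by
  simp [qBinom, qPoch_zero, qPoch_ne_zero hq hq]

lemma qBinom_succ_succ (hq : ‖q‖ < 1) {k r : ℕ} (h : r < k) :
    qBinom q (k + 1) (r + 1) = qBinom q k (r + 1) * q ^ (r + 1) + qBinom q k r := by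
  obtain ⟨s, rfl⟩ := Nat.exists_eq_add_of_lt h
  have e1 : r + s + 1 + 1 - (r + 1) = s + 1 := by omega
  have e2 : r + s + 1 - (r + 1) = s := by omega
  have e3 : r + s + 1 - r = s + 1 := by omega
  simp only [qBinom, e1, e2, e3, qPoch_self_succ q (r + s + 1), qPoch_self_succ q r,
    qPoch_self_succ q s]
  have h1 := one_sub_pow_succ_ne_zero hq r
  have h2 := one_sub_pow_succ_ne_zero hq s
  have h3 := qPoch_ne_zero hq hq r
  have h4 := qPoch_ne_zero hq hq s
  have h5 : 1 - q ^ (r + s + 1 + 1) = (1 - q ^ (s + 1)) * q ^ (r + 1) + (1 - q ^ (r + 1)) := by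
    ring
  rw [h5]
  generalize 1 - q ^ (r + 1) = A at h1 ⊢
  generalize 1 - q ^ (s + 1) = B at h2 ⊢
  field_simp

/-- Iterating `f(a) ↦ a f(a) + b f(aq)`, which sends `R_n` to `R_{n+1}`: the coefficients obey the
`q`-Pascal rule. -/
lemma rogersSzego_add (hq : ‖q‖ < 1) (n k : ℕ) (a b : ℂ) :
    rogersSzego q (n + k) a b =
      ∑ r ∈ range (k + 1), qBinom q k r * b ^ r * a ^ (k - r) * rogersSzego q n (a * q ^ r) b := by
  induction k generalizing n with
  | zero => simp [qBinom_zero_right hq]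
  | succ k ih =>
    rw [show n + (k + 1) = (n + 1) + k by ring, ih]
    have h1 : ∀ r ∈ range (k + 1),
        qBinom q k r * b ^ r * a ^ (k - r) * rogersSzego q (n + 1) (a * q ^ r) b =
        qBinom q k r * q ^ r * b ^ r * a ^ (k + 1 - r) * rogersSzego q n (a * q ^ r) b +
        qBinom q k r * b ^ (r + 1) * a ^ (k - r) * rogersSzego q n (a * q ^ (r + 1)) b := by
      intro r hr
      have hr' : r ≤ k := Nat.lt_succ_iff.mp (mem_range.mp hr)
      rw [rogersSzego_succ hq, Nat.succ_sub hr', pow_succ a, show a * q ^ r * q = a * q ^ (r + 1) by ring]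
      ring
    rw [sum_congr rfl h1, sum_add_distrib, sum_range_succ', sum_range_succ (n := k),
      sum_range_succ' (n := k + 1), sum_range_succ (n := k)]
    have h2 : ∀ r ∈ range k,
        qBinom q (k + 1) (r + 1) * b ^ (r + 1) * a ^ (k + 1 - (r + 1)) *
          rogersSzego q n (a * q ^ (r + 1)) b =
        qBinom q k (r + 1) * q ^ (r + 1) * b ^ (r + 1) * a ^ (k + 1 - (r + 1)) *
          rogersSzego q n (a * q ^ (r + 1)) b +
        qBinom q k r * b ^ (r + 1) * a ^ (k - r) * rogersSzego q n (a * q ^ (r + 1)) b := by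
      intro r hr
      rw [qBinom_succ_succ hq (mem_range.mp hr), Nat.succ_sub_succ]
      ring
    rw [sum_congr rfl h2, sum_add_distrib]
    simp only [qBinom_zero_right hq, qBinom_self hq, Nat.sub_self, Nat.sub_zero, pow_zero,
      Nat.succ_sub_succ]
    ring

/-- The polynomial `R_{n-k} / (q; q)_{n-k}`, read as zero for `k > n`. -/
noncomputable def rogersSzegoDivSub (q : ℂ) (n k : ℕ) (a b : ℂ) : ℂ :=
  if k ≤ n then rogersSzegoDiv q (n - k) a b else 0

lemma rogersSzegoDivSub_zero (q : ℂ) (n : ℕ) (a b : ℂ) :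
    rogersSzegoDivSub q n 0 a b = rogersSzegoDiv q n a b := by simp [rogersSzegoDivSub]

lemma rogersSzegoDivSub_succ (q : ℂ) (n k : ℕ) (a b : ℂ) :
    rogersSzegoDivSub q (n + 1) (k + 1) a b = rogersSzegoDivSub q n k a b := by
  simp [rogersSzegoDivSub]

lemma rogersSzegoDivSub_add (q : ℂ) (n k : ℕ) (a b : ℂ) :
    rogersSzegoDivSub q (n + k) k a b = rogersSzegoDiv q n a b := by
  simp [rogersSzegoDivSub]

lemma rogersSzegoDivSub_of_lt (q : ℂ) {n k : ℕ} (h : n < k) (a b : ℂ) :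
    rogersSzegoDivSub q n k a b = 0 := by simp [rogersSzegoDivSub, h]

lemma rogersSzegoDivSub_add_two (hq : ‖q‖ < 1) (n k : ℕ) (a b : ℂ) :
    (1 - q ^ (n + 2 - k)) * rogersSzegoDivSub q (n + 2) k a b =
      (a + b) * rogersSzegoDivSub q (n + 1) k a b - a * b * rogersSzegoDivSub q n k a b := by
  rcases Nat.lt_or_ge (n + 2) k with h | h
  · simp [rogersSzegoDivSub_of_lt q h, rogersSzegoDivSub_of_lt q (show n + 1 < k by omega),
      rogersSzegoDivSub_of_lt q (show n < k by omega)]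
  obtain ⟨m, hm⟩ := Nat.exists_eq_add_of_le' h
  rcases m with _ | _ | m
  · obtain rfl : k = n + 2 := by omega
    simp [rogersSzegoDivSub_of_lt q (show n + 1 < n + 2 by omega),
      rogersSzegoDivSub_of_lt q (show n < n + 2 by omega)]
  · obtain rfl : k = n + 1 := by omega
    rw [rogersSzegoDivSub_succ, rogersSzegoDivSub_of_lt q (show n < n + 1 by omega)]
    have := rogersSzegoDiv_one hq a b
    simpa [rogersSzegoDivSub, rogersSzegoDiv_zero] using this
  · obtain rfl : n = m + k := by omega
    have e1 : m + k + 2 - k = m + 2 := by omega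
    rw [e1, show m + k + 2 = m + 2 + k by ring, show m + k + 1 = m + 1 + k by ring]
    simp only [rogersSzegoDivSub_add]
    exact rogersSzegoDiv_add_two hq m a b

/-- Linearization `R_{n+m} = ∑_k q^{k(k-1)/2} (-uv)^k (q;q)_n (q;q)_m /
((q;q)_k (q;q)_{n-k} (q;q)_{m-k}) R_{n-k} R_{m-k}`, by induction on `n`: both sides
satisfy the same three-term recurrence, thanks to
`1 - q^n = (1 - q^{n-k}) + q^{n-k} (1 - q^k)`. -/
lemma rogersSzego_add_div (hq : ‖q‖ < 1) (u v : ℂ) (n m N : ℕ) (hN : n ≤ N) :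
    rogersSzego q (n + m) u v =
      qPoch q q n * qPoch q q m * ∑ k ∈ range (N + 1), eulerCoeff q (u * v) k *
        rogersSzegoDivSub q n k u v * rogersSzegoDivSub q m k u v := by
  induction n using Nat.twoStepInduction generalizing m N with
  | zero =>
    rw [sum_range_succ', sum_eq_zero]
    · simp [rogersSzego, eulerCoeff_zero, rogersSzegoDivSub_zero, rogersSzegoDiv_zero, qPoch_zero]
    · intro k _
      simp [rogersSzegoDivSub_of_lt]
  | one =>
    obtain ⟨N, rfl⟩ : ∃ M, N = M + 1 := ⟨N - 1, by omega⟩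
    rw [sum_range_succ', sum_range_succ', sum_eq_zero]
    · have h1 := rogersSzegoDiv_one hq u v
      have h2 := eulerCoeff_succ hq (u * v) 0
      have h3 : qPoch q q 1 = 1 - q := by simp [qPoch]
      simp only [zero_add, pow_zero, mul_one, pow_one] at h2
      simp only [zero_add, rogersSzegoDivSub_zero, rogersSzegoDivSub_succ, eulerCoeff_zero,
        rogersSzegoDiv_zero, one_mul, mul_one] at *
      rcases m with _ | m
      · simp [rogersSzegoDivSub_of_lt, rogersSzego, rogersSzegoDiv_zero, qPoch_zero]
      · rw [show 1 + (m + 1) = m + 2 by ring, rogersSzego_add_two hq, rogersSzegoDivSub_succ,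
          rogersSzegoDivSub_zero, rogersSzego, rogersSzego, h3, qPoch_self_succ]
        linear_combination (-qPoch q q m * (1 - q ^ (m + 1)) * rogersSzegoDiv q (m + 1) u v) * h1 -
          qPoch q q m * (1 - q ^ (m + 1)) * rogersSzegoDiv q m u v * h2
    · intro k _
      simp [rogersSzegoDivSub_of_lt]
  | more n ih0 ih1 =>
    have i0 := ih0 m N (by omega)
    have i1 := ih1 m N (by omega)
    have hrec : (1 - q ^ (n + 2)) * ∑ k ∈ range (N + 1), eulerCoeff q (u * v) k *
          rogersSzegoDivSub q (n + 2) k u v * rogersSzegoDivSub q m k u v =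
        (u + v) * (∑ k ∈ range (N + 1), eulerCoeff q (u * v) k *
          rogersSzegoDivSub q (n + 1) k u v * rogersSzegoDivSub q m k u v) -
        u * v * (∑ k ∈ range (N + 1), eulerCoeff q (u * v) k *
          rogersSzegoDivSub q n k u v * rogersSzegoDivSub q m k u v) +
        ∑ k ∈ range (N + 1), q ^ (n + 2 - k) * ((1 - q ^ k) * eulerCoeff q (u * v) k) *
          rogersSzegoDivSub q (n + 2) k u v * rogersSzegoDivSub q m k u v := by
      rw [mul_sum, mul_sum, mul_sum, ← sum_sub_distrib, ← sum_add_distrib]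
      refine sum_congr rfl fun k _ => ?_
      rcases Nat.lt_or_ge (n + 2) k with h | h
      · simp [rogersSzegoDivSub_of_lt q h, rogersSzegoDivSub_of_lt q (show n + 1 < k by omega),
          rogersSzegoDivSub_of_lt q (show n < k by omega)]
      · have h1 : q ^ (n + 2) = q ^ (n + 2 - k) * q ^ k := by rw [← pow_add, Nat.sub_add_cancel h]
        rw [h1]
        linear_combination eulerCoeff q (u * v) k * rogersSzegoDivSub q m k u v *
          rogersSzegoDivSub_add_two hq n k u v
    rw [qPoch_self_succ q (n + 1)]
    have hlast : qPoch q q (n + 1) * qPoch q q m *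
        ∑ k ∈ range (N + 1), q ^ (n + 2 - k) * ((1 - q ^ k) * eulerCoeff q (u * v) k) *
          rogersSzegoDivSub q (n + 2) k u v * rogersSzegoDivSub q m k u v =
        - (u * v) * q ^ (n + 1) * (1 - q ^ m) * rogersSzego q (n + m) u v := by
      rcases m with _ | m
      · rw [sum_eq_zero]
        · simp
        · rintro (_ | k) _
          · simp
          · simp [rogersSzegoDivSub_of_lt]
      · obtain ⟨N, rfl⟩ : ∃ M, N = M + 1 := ⟨N - 1, by omega⟩
        rw [show n + (m + 1) = n + 1 + m by ring, ih1 m N (by omega), sum_range_succ',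
          qPoch_self_succ q m]
        have h2 : ∀ k ∈ range (N + 1),
            q ^ (n + 2 - (k + 1)) * ((1 - q ^ (k + 1)) * eulerCoeff q (u * v) (k + 1)) *
              rogersSzegoDivSub q (n + 2) (k + 1) u v * rogersSzegoDivSub q (m + 1) (k + 1) u v =
            -(u * v) * q ^ (n + 1) * (eulerCoeff q (u * v) k *
              rogersSzegoDivSub q (n + 1) k u v * rogersSzegoDivSub q m k u v) := by
          intro k _
          rw [eulerCoeff_succ hq, rogersSzegoDivSub_succ, rogersSzegoDivSub_succ]
          rcases Nat.lt_or_ge (n + 1) k with h | h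
          · simp [rogersSzegoDivSub_of_lt q h]
          · have h1 : q ^ (n + 1) = q ^ (n + 2 - (k + 1)) * q ^ k := by
              rw [← pow_add]; congr 1; omega
            rw [h1]
            ring
        rw [sum_congr rfl h2, ← mul_sum]
        simp only [pow_zero, sub_self, zero_mul, mul_zero, add_zero]
        ring
    rw [show n + 2 + m = n + m + 2 by ring, rogersSzego_add_two hq]
    rw [show n + 1 + m = n + m + 1 by ring, qPoch_self_succ q n] at i1
    rw [qPoch_self_succ q n] at hlast ⊢
    rw [show n + 1 + 1 = n + 2 by ring]
    rw [show qPoch q q n * (1 - q ^ (n + 1)) * (1 - q ^ (n + 2)) * qPoch q q m *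
        ∑ k ∈ range (N + 1), eulerCoeff q (u * v) k *
          rogersSzegoDivSub q (n + 2) k u v * rogersSzegoDivSub q m k u v =
        qPoch q q n * (1 - q ^ (n + 1)) * qPoch q q m * ((1 - q ^ (n + 2)) *
        ∑ k ∈ range (N + 1), eulerCoeff q (u * v) k *
          rogersSzegoDivSub q (n + 2) k u v * rogersSzegoDivSub q m k u v) by ring, hrec]
    linear_combination (u + v) * i1 - u * v * (1 - q ^ (n + 1)) * i0 - hlast

end RogersSzego

/-! ### The `q`-Mehler formula and its shifted form -/

section Mehler

variable {q : ℂ}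

lemma exists_norm_rogersSzegoDiv_le (hq : ‖q‖ < 1) :
    ∃ C : ℝ, 1 ≤ C ∧ ∀ (n : ℕ) (a b : ℂ) (σ : ℝ), ‖a‖ ≤ σ → ‖b‖ ≤ σ →
      ‖rogersSzegoDiv q n a b‖ ≤ C * (n + 1) * σ ^ n ∧
        ‖rogersSzego q n a b‖ ≤ C * (n + 1) * σ ^ n := by
  obtain ⟨C, h1, hC⟩ := exists_norm_qPoch_le hq
  have h0 : 0 ≤ C := by linarith
  have key : ∀ (n : ℕ) (a b : ℂ) (σ : ℝ), ‖a‖ ≤ σ → ‖b‖ ≤ σ →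
      ‖rogersSzegoDiv q n a b‖ ≤ C ^ 2 * (n + 1) * σ ^ n := by
    intro n a b σ ha hb
    have hσ : 0 ≤ σ := (norm_nonneg _).trans ha
    refine (norm_sum_le _ _).trans ?_
    calc _ ≤ ∑ p ∈ antidiagonal n, C ^ 2 * σ ^ n := by
          refine sum_le_sum fun p hp => ?_
          rw [HasAntidiagonal.mem_antidiagonal] at hp
          rw [norm_mul, norm_mul, norm_mul, norm_pow, norm_pow, ← hp, pow_add, pow_two]
          calc _ ≤ (C * σ ^ p.1) * (C * σ ^ p.2) := by
                have e1 := (hC p.1).2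
                have e2 := (hC p.2).2
                gcongr
            _ = _ := by ring
      _ = _ := by
          rw [sum_const, Nat.card_antidiagonal, nsmul_eq_mul]
          push_cast
          ring
  refine ⟨C ^ 3, one_le_pow₀ h1, fun n a b σ ha hb => ?_⟩
  have hσ : 0 ≤ σ := (norm_nonneg _).trans ha
  constructor
  · refine (key n a b σ ha hb).trans ?_
    have : C ^ 2 ≤ C ^ 3 := pow_le_pow_right₀ h1 (by norm_num)
    gcongr
  · rw [rogersSzego, norm_mul]
    calc _ ≤ C * (C ^ 2 * (n + 1) * σ ^ n) :=
          mul_le_mul (hC n).1 (key n a b σ ha hb) (norm_nonneg _) h0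
      _ = _ := by ring

lemma rogersSzegoDiv_mul_pow (q : ℂ) (n : ℕ) (a b x : ℂ) :
    rogersSzegoDiv q n a b * x ^ n = ∑ p ∈ antidiagonal n,
      ((qPoch q q p.1)⁻¹ * (a * x) ^ p.1) * ((qPoch q q p.2)⁻¹ * (b * x) ^ p.2) := by
  rw [rogersSzegoDiv, sum_mul]
  refine sum_congr rfl fun p hp => ?_
  rw [HasAntidiagonal.mem_antidiagonal] at hp
  rw [← hp, pow_add, mul_pow, mul_pow]
  ring

lemma summable_norm_rogersSzegoDiv_mul_pow (hq : ‖q‖ < 1) {a b x : ℂ} (ha : ‖a * x‖ < 1)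
    (hb : ‖b * x‖ < 1) : Summable fun n => ‖rogersSzegoDiv q n a b * x ^ n‖ := by
  simp only [rogersSzegoDiv_mul_pow]
  exact summable_norm_sum_mul_antidiagonal_of_summable_norm
    (f := fun i => (qPoch q q i)⁻¹ * (a * x) ^ i) (g := fun i => (qPoch q q i)⁻¹ * (b * x) ^ i)
    (summable_norm_pow_div_qPoch hq ha) (summable_norm_pow_div_qPoch hq hb)

lemma tsum_rogersSzegoDiv_mul_pow (hq : ‖q‖ < 1) {a b x : ℂ} (ha : ‖a * x‖ < 1)
    (hb : ‖b * x‖ < 1) : ∑' n, rogersSzegoDiv q n a b * x ^ n =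
      (qPochInf (a * x) q)⁻¹ * (qPochInf (b * x) q)⁻¹ := by
  simp only [rogersSzegoDiv_mul_pow]
  rw [← tsum_pow_div_qPoch hq ha, ← tsum_pow_div_qPoch hq hb]
  exact (tsum_mul_tsum_eq_tsum_sum_antidiagonal_of_summable_norm
    (summable_norm_pow_div_qPoch hq ha) (summable_norm_pow_div_qPoch hq hb)).symm

lemma summable_add_one_sq_mul_pow {r : ℝ} (h0 : 0 ≤ r) (h1 : r < 1) :
    Summable fun n : ℕ => ((n : ℝ) + 1) ^ 2 * r ^ n := by
  have hr : ‖r‖ < 1 := by rwa [Real.norm_of_nonneg h0]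
  have := ((summable_pow_mul_geometric_of_norm_lt_one 2 hr).add
    ((summable_pow_mul_geometric_of_norm_lt_one 1 hr).mul_left 2)).add
    (summable_pow_mul_geometric_of_norm_lt_one 0 hr)
  refine this.congr fun n => ?_
  ring

/-- If `α` is a sequence of at most the growth of `R_n(a, b)`, its pairing with the shifted
sequence `n ↦ R_n(u, v) / (q; q)_n`. -/
noncomputable def shiftedPairing (q u v : ℂ) (α : ℕ → ℂ) (k : ℕ) : ℂ :=
  ∑' n, α (n + k) * rogersSzegoDiv q n u v

lemma norm_shift_mul_le {α ρ : ℕ → ℂ} {A C σ τ : ℝ} (hA : 0 ≤ A) (hσ : 0 ≤ σ)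
    (hα : ∀ n, ‖α n‖ ≤ A * (n + 1) * σ ^ n) (hρ : ∀ n, ‖ρ n‖ ≤ C * (n + 1) * τ ^ n) (n k : ℕ) :
    ‖α (n + k) * ρ n‖ ≤ (A * (k + 1) * σ ^ k) * (C * ((n + 1) ^ 2 * (σ * τ) ^ n)) := by
  have h1 : ‖α (n + k)‖ ≤ A * ((n + 1) * (k + 1)) * σ ^ (n + k) := by
    refine (hα _).trans ?_
    have : ((n + k : ℕ) : ℝ) + 1 ≤ (n + 1) * (k + 1) := by
      push_cast
      nlinarith [(Nat.cast_nonneg n : (0 : ℝ) ≤ n), (Nat.cast_nonneg k : (0 : ℝ) ≤ k)]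
    gcongr
  rw [norm_mul]
  refine (mul_le_mul h1 (hρ n) (norm_nonneg _) (by positivity)).trans_eq ?_
  rw [pow_add, mul_pow]
  ring

lemma summable_shift_mul {α ρ : ℕ → ℂ} {A C σ τ : ℝ} (hA : 0 ≤ A) (hσ : 0 ≤ σ) (hτ : 0 ≤ τ)
    (hστ : σ * τ < 1)
    (hα : ∀ n, ‖α n‖ ≤ A * (n + 1) * σ ^ n) (hρ : ∀ n, ‖ρ n‖ ≤ C * (n + 1) * τ ^ n) (k : ℕ) :
    Summable fun n => α (n + k) * ρ n :=
  Summable.of_norm_bounded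
    (((summable_add_one_sq_mul_pow (mul_nonneg hσ hτ) hστ).mul_left C).mul_left _)
    fun n => norm_shift_mul_le hA hσ hα hρ n k

lemma hasSum_const_mul_mul {f g : ℕ → ℂ} (c : ℂ) (hf : Summable f) (hg : Summable g) :
    HasSum (fun p : ℕ × ℕ => c * (f p.1 * g p.2)) (c * ((∑' n, f n) * ∑' n, g n)) := by
  have h := summable_mul_of_summable_norm hf.norm hg.norm
  rw [hf.tsum_mul_tsum hg h]
  exact h.hasSum.mul_left c

/-- Summing the linearization formula for `R_{n+m}(u, v)` against two sequences of geometric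
growth; the double sum becomes a single sum of products because the triple sum over
`(k, n, m) ↦ (n + k, m + k)` converges absolutely. -/
theorem hasSum_mul_rogersSzego_add (hq : ‖q‖ < 1) {u v : ℂ} {α β : ℕ → ℂ} {A B σ σ' τ : ℝ}
    (hA : 0 ≤ A) (hB : 0 ≤ B) (hσ : 0 ≤ σ) (hσ' : 0 ≤ σ') (hu : ‖u‖ ≤ τ) (hv : ‖v‖ ≤ τ)
    (hστ : σ * τ < 1) (hστ' : σ' * τ < 1)
    (hα : ∀ n, ‖α n‖ ≤ A * (n + 1) * σ ^ n) (hβ : ∀ n, ‖β n‖ ≤ B * (n + 1) * σ' ^ n) :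
    Summable (fun k => eulerCoeff q (u * v) k *
      (shiftedPairing q u v α k * shiftedPairing q u v β k)) ∧
    HasSum (fun p : ℕ × ℕ => ((qPoch q q p.1)⁻¹ * α p.1) * ((qPoch q q p.2)⁻¹ * β p.2) *
      rogersSzego q (p.1 + p.2) u v)
      (∑' k, eulerCoeff q (u * v) k *
        (shiftedPairing q u v α k * shiftedPairing q u v β k)) := by
  obtain ⟨C, hC1, hC⟩ := exists_norm_rogersSzegoDiv_le hq
  obtain ⟨D, hD1, hD⟩ := exists_norm_eulerCoeff_le hq
  have hτ : 0 ≤ τ := (norm_nonneg _).trans hu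
  have hC0 : 0 ≤ C := by linarith
  have hρ : ∀ n, ‖rogersSzegoDiv q n u v‖ ≤ C * (n + 1) * τ ^ n := fun n => (hC n u v τ hu hv).1
  set G : ℕ × ℕ × ℕ → ℂ := fun p => eulerCoeff q (u * v) p.1 *
    ((α (p.2.1 + p.1) * rogersSzegoDiv q p.2.1 u v) *
      (β (p.2.2 + p.1) * rogersSzegoDiv q p.2.2 u v)) with hG
  have hr : (σ * τ) * (σ' * τ) < 1 :=
    mul_lt_one_of_nonneg_of_lt_one_left (by positivity) hστ hστ'.le
  have hGs : Summable G := by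
    refine Summable.of_norm_bounded
      (g := fun p : ℕ × ℕ × ℕ => (D * A * B * (((p.1 : ℝ) + 1) ^ 2 * ((σ * τ) * (σ' * τ)) ^ p.1)) *
        ((C * (((p.2.1 : ℝ) + 1) ^ 2 * (σ * τ) ^ p.2.1)) *
          (C * (((p.2.2 : ℝ) + 1) ^ 2 * (σ' * τ) ^ p.2.2)))) ?_ ?_
    · have t1 := (summable_add_one_sq_mul_pow (by positivity) hr).mul_left (D * A * B)
      have t2 := (summable_add_one_sq_mul_pow (by positivity) hστ).mul_left C
      have t3 := (summable_add_one_sq_mul_pow (by positivity) hστ').mul_left C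
      have t4 := t2.mul_of_nonneg t3 (fun _ => by positivity) (fun _ => by positivity)
      exact t1.mul_of_nonneg t4 (fun _ => by positivity) (fun _ => by positivity)
    · rintro ⟨k, n, m⟩
      have e1 := norm_shift_mul_le hA hσ hα hρ n k
      have e2 := norm_shift_mul_le hB hσ' hβ hρ m k
      have e3 : ‖eulerCoeff q (u * v) k‖ ≤ D * (τ * τ) ^ k := by
        refine (hD _ k).trans ?_
        rw [norm_mul]
        gcongr
      simp only [hG]
      rw [norm_mul, norm_mul]
      have e4 := mul_le_mul e1 e2 (norm_nonneg _) ((norm_nonneg _).trans e1)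
      refine (mul_le_mul e3 e4 (by positivity) (by positivity)).trans_eq ?_
      simp only [mul_pow]
      ring
  have hGk : ∀ k, HasSum (fun p : ℕ × ℕ => G (k, p)) (eulerCoeff q (u * v) k *
      (shiftedPairing q u v α k * shiftedPairing q u v β k)) := by
    intro k
    have s1 := summable_shift_mul hA hσ hτ hστ hα hρ k
    have s2 := summable_shift_mul hB hσ' hτ hστ' hβ hρ k
    have h := hasSum_const_mul_mul (f := fun n => α (n + k) * rogersSzegoDiv q n u v)
      (g := fun n => β (n + k) * rogersSzegoDiv q n u v) (eulerCoeff q (u * v) k) s1 s2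
    simp only [hG, shiftedPairing]
    exact h
  have hGt := hGs.hasSum.prod_fiberwise hGk
  refine ⟨hGt.summable, ?_⟩
  rw [hGt.tsum_eq]
  set e : ℕ × ℕ × ℕ → (ℕ × ℕ) × ℕ := fun p => ((p.2.1 + p.1, p.2.2 + p.1), p.1) with he
  have hinj : Function.Injective e := by
    rintro ⟨k, n, m⟩ ⟨k', n', m'⟩ h
    simp only [he, Prod.mk.injEq] at h
    obtain ⟨⟨h1, h2⟩, rfl⟩ := h
    simp only [Prod.mk.injEq, true_and]
    omega
  set G' : (ℕ × ℕ) × ℕ → ℂ := fun p => α p.1.1 * β p.1.2 * (eulerCoeff q (u * v) p.2 *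
    rogersSzegoDivSub q p.1.1 p.2 u v * rogersSzegoDivSub q p.1.2 p.2 u v) with hG'
  have hG'e : G' ∘ e = G := by
    funext ⟨k, n, m⟩
    simp only [hG', he, hG, Function.comp, rogersSzegoDivSub_add]
    ring
  have hG's : HasSum G' (∑' p, G p) := by
    rw [← hinj.hasSum_iff, hG'e]
    · exact hGs.hasSum
    · rintro ⟨⟨n, m⟩, k⟩ hp
      simp only [hG']
      rcases Nat.lt_or_ge n k with h | h
      · simp [rogersSzegoDivSub_of_lt q h]
      rcases Nat.lt_or_ge m k with h' | h'
      · simp [rogersSzegoDivSub_of_lt q h']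
      · refine absurd ⟨(k, n - k, m - k), ?_⟩ hp
        simp [he, Nat.sub_add_cancel h, Nat.sub_add_cancel h']
  refine hG's.prod_fiberwise fun p => ?_
  have hfin : HasSum (fun k => G' (p, k)) (∑ k ∈ range (p.1 + 1), G' (p, k)) :=
    hasSum_sum_of_ne_finset_zero fun k hk => by
      have : p.1 < k := by simpa using hk
      simp [hG', rogersSzegoDivSub_of_lt q this]
  convert hfin using 1
  rw [rogersSzego_add_div hq u v p.1 p.2 p.1 le_rfl]
  simp only [hG']
  rw [← mul_sum]
  have := qPoch_ne_zero hq hq p.1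
  have := qPoch_ne_zero hq hq p.2
  field_simp

lemma shiftedPairing_pow (hq : ‖q‖ < 1) {a u v : ℂ} (hau : ‖a * u‖ < 1) (hav : ‖a * v‖ < 1)
    (k : ℕ) : shiftedPairing q u v (a ^ ·) k =
      a ^ k * ((qPochInf (a * u) q)⁻¹ * (qPochInf (a * v) q)⁻¹) := by
  rw [mul_comm a u, mul_comm a v,
    ← tsum_rogersSzegoDiv_mul_pow hq (by rwa [mul_comm]) (by rwa [mul_comm]), ← tsum_mul_left]
  refine tsum_congr fun n => ?_
  ring

lemma max_norm_mul_max_norm_lt_one {a b u v : ℂ} (hau : ‖a * u‖ < 1) (hbu : ‖b * u‖ < 1)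
    (hav : ‖a * v‖ < 1) (hbv : ‖b * v‖ < 1) : max ‖a‖ ‖b‖ * max ‖u‖ ‖v‖ < 1 := by
  rw [norm_mul] at *
  rcases max_choice ‖a‖ ‖b‖ with h | h <;> rcases max_choice ‖u‖ ‖v‖ with h' | h' <;>
    rwa [h, h']

/-- The `q`-Mehler formula, the bilinear generating function of Rogers–Szegő polynomials. -/
theorem tsum_rogersSzego_mul_rogersSzegoDiv (hq : ‖q‖ < 1) {a b u v : ℂ} (hau : ‖a * u‖ < 1)
    (hbu : ‖b * u‖ < 1) (hav : ‖a * v‖ < 1) (hbv : ‖b * v‖ < 1) :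
    ∑' n, rogersSzego q n a b * rogersSzegoDiv q n u v =
      qPochInf (a * b * u * v) q * ((qPochInf (a * u) q)⁻¹ * (qPochInf (a * v) q)⁻¹) *
        ((qPochInf (b * u) q)⁻¹ * (qPochInf (b * v) q)⁻¹) := by
  have hm := max_norm_mul_max_norm_lt_one hau hbu hav hbv
  have hbd : ∀ x : ℂ, ‖x‖ ≤ max ‖a‖ ‖b‖ →
      ∀ n : ℕ, ‖x ^ n‖ ≤ 1 * ((n : ℝ) + 1) * max ‖a‖ ‖b‖ ^ n := by
    intro x hx n
    rw [norm_pow, one_mul]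
    calc ‖x‖ ^ n ≤ max ‖a‖ ‖b‖ ^ n := by gcongr
      _ ≤ _ := le_mul_of_one_le_left (by positivity) (by simp)
  have h0 : 0 ≤ max ‖a‖ ‖b‖ := (norm_nonneg a).trans (le_max_left _ _)
  obtain ⟨-, h⟩ := hasSum_mul_rogersSzego_add hq zero_le_one zero_le_one h0 h0
    (le_max_left _ _) (le_max_right _ _) hm hm (hbd a (le_max_left _ _)) (hbd b (le_max_right _ _))
  have h' := ((HasAntidiagonal.sigmaAntidiagonalEquivProd (A := ℕ)).hasSum_iff.mpr h).sigma fun n => hasSum_fintype _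
  have hz : ‖a * b * u * v‖ < 1 := by
    rw [show a * b * u * v = (a * u) * (b * v) by ring]
    exact norm_mul_lt_one hau hbv
  simp only [shiftedPairing_pow hq hau hav, shiftedPairing_pow hq hbu hbv] at h'
  have e : ∀ k, eulerCoeff q (u * v) k *
      (a ^ k * ((qPochInf (a * u) q)⁻¹ * (qPochInf (a * v) q)⁻¹) *
        (b ^ k * ((qPochInf (b * u) q)⁻¹ * (qPochInf (b * v) q)⁻¹))) =
      eulerCoeff q (a * b * u * v) k *
        (((qPochInf (a * u) q)⁻¹ * (qPochInf (a * v) q)⁻¹) *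
        ((qPochInf (b * u) q)⁻¹ * (qPochInf (b * v) q)⁻¹)) := by
    intro k
    rw [show a * b * u * v = u * v * (a * b) by ring, ← eulerCoeff_mul_pow q (u * v) (a * b), mul_pow]
    ring
  simp only [e, tsum_mul_right, tsum_eulerCoeff hq hz] at h'
  rw [mul_assoc (qPochInf (a * b * u * v) q), ← h'.tsum_eq]
  refine tsum_congr fun n => ?_
  rw [show rogersSzego q n a b * rogersSzegoDiv q n u v =
    rogersSzegoDiv q n a b * rogersSzego q n u v by simp only [rogersSzego]; ring,
    rogersSzegoDiv, sum_mul, ← sum_coe_sort (antidiagonal n)]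
  refine sum_congr rfl fun p _ => ?_
  have hp := HasAntidiagonal.mem_antidiagonal.mp p.2
  simp only [Function.comp, HasAntidiagonal.sigmaAntidiagonalEquivProd_apply]
  rw [hp]

/-- The shifted `q`-Mehler formula, whose right-hand side carries `H_k(a, b, u, v)`. -/
theorem shiftedPairing_rogersSzego (hq : ‖q‖ < 1) {a b u v : ℂ} (hau : ‖a * u‖ < 1)
    (hbu : ‖b * u‖ < 1) (hav : ‖a * v‖ < 1) (hbv : ‖b * v‖ < 1) (k : ℕ) :
    shiftedPairing q u v (fun n => rogersSzego q n a b) k =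
      qPochInf (a * b * u * v) q * ((qPochInf (a * u) q)⁻¹ * (qPochInf (a * v) q)⁻¹) *
        ((qPochInf (b * u) q)⁻¹ * (qPochInf (b * v) q)⁻¹) * andrewsAskeyH q k a b u v := by
  obtain ⟨C, hC1, hC⟩ := exists_norm_rogersSzegoDiv_le hq
  have hm := max_norm_mul_max_norm_lt_one hau hbu hav hbv
  have h0 : 0 ≤ max ‖a‖ ‖b‖ := (norm_nonneg a).trans (le_max_left _ _)
  have h0' : 0 ≤ max ‖u‖ ‖v‖ := (norm_nonneg u).trans (le_max_left _ _)
  have hle : ∀ r : ℕ, ‖a * q ^ r‖ ≤ max ‖a‖ ‖b‖ := fun r => by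
    rw [norm_mul, norm_pow]
    exact (mul_le_of_le_one_right (norm_nonneg _) (pow_le_one₀ (norm_nonneg _) hq.le)).trans
      (le_max_left _ _)
  have hs : ∀ r : ℕ, Summable fun n =>
      rogersSzego q n (a * q ^ r) b * rogersSzegoDiv q n u v := fun r =>
    summable_shift_mul (α := fun n => rogersSzego q n (a * q ^ r) b)
      (zero_le_one.trans hC1) h0 h0' hm
      (fun n => (hC n _ _ _ (hle r) (le_max_right _ _)).2)
      (fun n => (hC n _ _ _ (le_max_left _ _) (le_max_right _ _)).1) 0
  simp only [shiftedPairing, rogersSzego_add hq _ k, sum_mul, mul_assoc _ (rogersSzego _ _ _ _)]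
  rw [Summable.tsum_finsetSum fun r _ => (hs r).mul_left _, andrewsAskeyH, mul_sum]
  refine sum_congr rfl fun r _ => ?_
  have hz : ‖a * b * u * v‖ < 1 := by
    rw [show a * b * u * v = (a * u) * (b * v) by ring]
    exact norm_mul_lt_one hau hbv
  have c1 : a * q ^ r * u = a * u * q ^ r := by ring
  have c2 : a * q ^ r * v = a * v * q ^ r := by ring
  have c3 : a * q ^ r * b * u * v = a * b * u * v * q ^ r := by ring
  rw [tsum_mul_left, tsum_rogersSzego_mul_rogersSzegoDiv hq
    (by rw [c1]; exact norm_mul_pow_lt_one hq hau r) hbu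
    (by rw [c2]; exact norm_mul_pow_lt_one hq hav r) hbv, c1, c2, c3,
    ← qPoch_mul_qPochInf hq (a * u) r, ← qPoch_mul_qPochInf hq (a * v) r,
    ← qPoch_mul_qPochInf hq (a * b * u * v) r]
  have := qPoch_ne_zero hq hau r
  have := qPoch_ne_zero hq hav r
  have := qPoch_ne_zero hq hz r
  field_simp

end Mehler

/-! ### Moments of the weight `(qx/u, qx/v; q)_∞` -/

section Moments

variable {q : ℂ}

/-- The weight `(qx/u, qx/v; q)_∞` (the weight of the Al-Salam–Carlitz polynomials). -/
noncomputable def alSalamCarlitzWeight (q u v x : ℂ) : ℂ :=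
  qPochInf (q * x / u) q * qPochInf (q * x / v) q

/-- The `n`-th moment of the weight, for the Jackson integral without its factor `1 - q`. -/
noncomputable def weightMoment (q u v : ℂ) (n : ℕ) : ℂ :=
  ∑' j, jacksonTerm q u v (fun x => alSalamCarlitzWeight q u v x * x ^ n) j

lemma exists_norm_weight_le (hq : ‖q‖ < 1) (u v y : ℂ) :
    ∃ W : ℝ, 0 ≤ W ∧ ∀ n : ℕ, ‖alSalamCarlitzWeight q u v (y * q ^ n)‖ ≤ W := by
  have h := (tendsto_qPochInf_mul_pow hq (q * y / u)).mul
    (tendsto_qPochInf_mul_pow hq (q * y / v))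
  obtain ⟨W, hW⟩ := (Metric.isBounded_range_of_tendsto _ h).exists_norm_le
  refine ⟨W, (norm_nonneg _).trans (hW _ ⟨0, rfl⟩), fun n => ?_⟩
  have e : alSalamCarlitzWeight q u v (y * q ^ n) =
      qPochInf (q * y / u * q ^ n) q * qPochInf (q * y / v * q ^ n) q := by
    rw [alSalamCarlitzWeight, ← mul_assoc, div_mul_eq_mul_div, div_mul_eq_mul_div]
  rw [e]
  exact hW _ ⟨n, rfl⟩

lemma jacksonTerm_swap (q u v : ℂ) (f : ℂ → ℂ) (n : ℕ) :
    jacksonTerm q v u f n = -jacksonTerm q u v f n := by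
  simp only [jacksonTerm]
  ring

lemma weightMoment_swap (q u v : ℂ) (n : ℕ) : weightMoment q v u n = -weightMoment q u v n := by
  rw [weightMoment, weightMoment, ← tsum_neg]
  refine tsum_congr fun j => ?_
  rw [jacksonTerm_swap]
  simp only [alSalamCarlitzWeight, mul_comm (qPochInf (q * _ / v) q)]

/-- Term-by-term integration against the weight of an absolutely convergent series of monomials.
The expansion is only needed at the nodes `u q^j` and `v q^j`. -/
lemma tsum_jacksonTerm_eq_tsum_moment (hq : ‖q‖ < 1) {u v : ℂ} {ι : Type*} {c : ι → ℂ}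
    {d : ι → ℕ} (hcu : Summable fun i => ‖c i * u ^ d i‖) (hcv : Summable fun i => ‖c i * v ^ d i‖)
    {f : ℂ → ℂ}
    (hfu : ∀ j : ℕ, f (u * q ^ j) =
      alSalamCarlitzWeight q u v (u * q ^ j) * ∑' i, c i * (u * q ^ j) ^ d i)
    (hfv : ∀ j : ℕ, f (v * q ^ j) =
      alSalamCarlitzWeight q u v (v * q ^ j) * ∑' i, c i * (v * q ^ j) ^ d i) :
    Summable (jacksonTerm q u v f) ∧
      ∑' j, jacksonTerm q u v f j = ∑' i, c i * weightMoment q u v (d i) := by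
  obtain ⟨U, hU0, hU⟩ := exists_norm_weight_le hq u v u
  obtain ⟨V, hV0, hV⟩ := exists_norm_weight_le hq u v v
  have hle : ∀ (y : ℂ) (j : ℕ) (i : ι), ‖c i * (y * q ^ j) ^ d i‖ ≤ ‖c i * y ^ d i‖ := by
    intro y j i
    rw [norm_mul, norm_mul, norm_pow, norm_pow, norm_mul, norm_pow]
    have : ‖y‖ * ‖q‖ ^ j ≤ ‖y‖ :=
      mul_le_of_le_one_right (norm_nonneg _) (pow_le_one₀ (norm_nonneg _) hq.le)
    gcongr
  set T : ℕ × ι → ℂ := fun p => c p.2 *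
    jacksonTerm q u v (fun x => alSalamCarlitzWeight q u v x * x ^ d p.2) p.1 with hT
  have hTs : Summable T := by
    have hb := (summable_geometric_of_lt_one (norm_nonneg q) hq).mul_of_nonneg
      ((hcv.mul_left (‖v‖ * V)).add (hcu.mul_left (‖u‖ * U)))
      (fun _ => by positivity) (fun _ => by positivity)
    refine Summable.of_norm_bounded hb ?_
    rintro ⟨j, i⟩
    have e : T (j, i) = q ^ j *
        (v * alSalamCarlitzWeight q u v (v * q ^ j) * (c i * (v * q ^ j) ^ d i) -
          u * alSalamCarlitzWeight q u v (u * q ^ j) * (c i * (u * q ^ j) ^ d i)) := by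
      simp only [hT, jacksonTerm]
      ring
    rw [e, norm_mul, norm_pow]
    refine mul_le_mul_of_nonneg_left ((norm_sub_le _ _).trans (add_le_add ?_ ?_)) (by positivity)
    · rw [norm_mul, norm_mul]
      have := hV j
      have := hle v j i
      gcongr
    · rw [norm_mul, norm_mul]
      have := hU j
      have := hle u j i
      gcongr
  have hfib : ∀ j, HasSum (fun i => T (j, i)) (jacksonTerm q u v f j) := by
    intro j
    have s1 : Summable fun i => c i * (v * q ^ j) ^ d i :=
      Summable.of_norm_bounded hcv fun i => hle v j i
    have s2 : Summable fun i => c i * (u * q ^ j) ^ d i :=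
      Summable.of_norm_bounded hcu fun i => hle u j i
    have h := (((s1.hasSum.mul_left (alSalamCarlitzWeight q u v (v * q ^ j))).mul_left v).sub
      ((s2.hasSum.mul_left (alSalamCarlitzWeight q u v (u * q ^ j))).mul_left u)).mul_right (q ^ j)
    rw [← hfu, ← hfv] at h
    have e : ∀ i, T (j, i) =
        (v * (alSalamCarlitzWeight q u v (v * q ^ j) * (c i * (v * q ^ j) ^ d i)) -
          u * (alSalamCarlitzWeight q u v (u * q ^ j) * (c i * (u * q ^ j) ^ d i))) * q ^ j := by
      intro i
      simp only [hT, jacksonTerm]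
      ring
    simp only [e]
    exact h
  have h1 := hTs.hasSum.prod_fiberwise hfib
  refine ⟨h1.summable, ?_⟩
  rw [h1.tsum_eq, ← (Equiv.prodComm ι ℕ).tsum_eq T]
  refine ((Equiv.prodComm ι ℕ).summable_iff.mpr hTs).tsum_prod.trans ?_
  refine tsum_congr fun i => ?_
  rw [weightMoment, ← tsum_mul_left]
  rfl

lemma summable_weight_mul_pow (hq : ‖q‖ < 1) (u v : ℂ) (n : ℕ) :
    Summable (jacksonTerm q u v fun x => alSalamCarlitzWeight q u v x * x ^ n) :=
  (tsum_jacksonTerm_eq_tsum_moment hq (ι := Unit) (c := fun _ => 1) (d := fun _ => n)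
    (Summable.of_finite) (Summable.of_finite) (by simp) (by simp)).1

/-- The fundamental theorem of `q`-calculus: the Jackson integral of a `q`-difference quotient. -/
lemma tsum_jacksonTerm_of_sub {u v L : ℂ} {g φ : ℂ → ℂ}
    (hs : Summable (jacksonTerm q u v g)) (hg : ∀ x, x * g x = φ x - φ (x * q))
    (hu : Tendsto (fun n : ℕ => φ (u * q ^ n)) atTop (𝓝 L))
    (hv : Tendsto (fun n : ℕ => φ (v * q ^ n)) atTop (𝓝 L)) :
    ∑' j, jacksonTerm q u v g j = φ v - φ u := by
  have hsum : ∀ n, ∑ j ∈ range n, jacksonTerm q u v g j =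
      (φ v - φ u) - (φ (v * q ^ n) - φ (u * q ^ n)) := by
    intro n
    induction n with
    | zero => simp
    | succ n ih =>
      rw [sum_range_succ, ih, jacksonTerm]
      have h1 := hg (v * q ^ n)
      have h2 := hg (u * q ^ n)
      rw [mul_assoc v _ q, ← pow_succ] at h1
      rw [mul_assoc u _ q, ← pow_succ] at h2
      linear_combination h1 - h2
  refine tendsto_nhds_unique hs.hasSum.tendsto_sum_nat ?_
  simp only [hsum]
  simpa using (hv.sub hu).const_sub (φ v - φ u)

lemma qPochInf_one (hq : ‖q‖ < 1) : qPochInf 1 q = 0 := by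
  simp [qPochInf_eq_one_sub_mul hq 1]

lemma tendsto_qPochInf_div_mul_pow (hq : ‖q‖ < 1) (y u v : ℂ) :
    Tendsto (fun n : ℕ => qPochInf (y * q ^ n / u) q * qPochInf (y * q ^ n / v) q)
      atTop (𝓝 1) := by
  have h := (tendsto_qPochInf_mul_pow hq (y / u)).mul (tendsto_qPochInf_mul_pow hq (y / v))
  rw [mul_one] at h
  refine h.congr fun n => ?_
  rw [div_mul_eq_mul_div, div_mul_eq_mul_div]

lemma qPochInf_div_mul_qPochInf_div (hq : ‖q‖ < 1) (u v x : ℂ) :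
    qPochInf (x / u) q * qPochInf (x / v) q =
      (1 - x / u) * (1 - x / v) * alSalamCarlitzWeight q u v x := by
  rw [qPochInf_eq_one_sub_mul hq (x / u), qPochInf_eq_one_sub_mul hq (x / v),
    alSalamCarlitzWeight, div_mul_eq_mul_div, div_mul_eq_mul_div, mul_comm x q]
  ring

lemma weightMoment_one (hq : ‖q‖ < 1) {u v : ℂ} (hu : u ≠ 0) (hv : v ≠ 0) :
    weightMoment q u v 1 = (u + v) * weightMoment q u v 0 := by
  set φ : ℂ → ℂ := fun x => qPochInf (x / u) q * qPochInf (x / v) q with hφ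
  have h := ((summable_weight_mul_pow hq u v 1).hasSum.mul_left (u * v)⁻¹).sub
    ((summable_weight_mul_pow hq u v 0).hasSum.mul_left (u⁻¹ + v⁻¹))
  have e : ∀ j, (u * v)⁻¹ * jacksonTerm q u v (fun x => alSalamCarlitzWeight q u v x * x ^ 1) j -
      (u⁻¹ + v⁻¹) * jacksonTerm q u v (fun x => alSalamCarlitzWeight q u v x * x ^ 0) j =
      jacksonTerm q u v
        (fun x => alSalamCarlitzWeight q u v x * ((u * v)⁻¹ * x - (u⁻¹ + v⁻¹))) j := by
    intro j
    simp only [jacksonTerm]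
    ring
  simp only [e] at h
  have key := tsum_jacksonTerm_of_sub (φ := φ) h.summable (fun x => by
    simp only [hφ]
    rw [qPochInf_div_mul_qPochInf_div hq, mul_comm x q, ← alSalamCarlitzWeight]
    field_simp
    ring) (tendsto_qPochInf_div_mul_pow hq u u v) (tendsto_qPochInf_div_mul_pow hq v u v)
  rw [h.tsum_eq] at key
  simp only [hφ, div_self hu, div_self hv, qPochInf_one hq, mul_zero, zero_mul, sub_zero] at key
  change (u * v)⁻¹ * weightMoment q u v 1 - (u⁻¹ + v⁻¹) * weightMoment q u v 0 = 0 at key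
  field_simp at key
  linear_combination key

/-- `q`-integration by parts turns `w(x/q) = (x/u, x/v; q)_∞ = (1 - x/u)(1 - x/v) w(x)` into the
three-term recurrence of the Rogers–Szegő polynomials. -/
lemma weightMoment_add_two (hq : ‖q‖ < 1) {u v : ℂ} (hu : u ≠ 0) (hv : v ≠ 0) (n : ℕ) :
    weightMoment q u v (n + 2) = (u + v) * weightMoment q u v (n + 1) -
      u * v * (1 - q ^ (n + 1)) * weightMoment q u v n := by
  set φ : ℂ → ℂ := fun x => qPochInf (x / u) q * qPochInf (x / v) q * x ^ (n + 1) with hφ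
  have h := (((summable_weight_mul_pow hq u v (n + 2)).hasSum.mul_left (u * v)⁻¹).sub
    ((summable_weight_mul_pow hq u v (n + 1)).hasSum.mul_left (u⁻¹ + v⁻¹))).add
    ((summable_weight_mul_pow hq u v n).hasSum.mul_left (1 - q ^ (n + 1)))
  have e : ∀ j,
      (u * v)⁻¹ * jacksonTerm q u v (fun x => alSalamCarlitzWeight q u v x * x ^ (n + 2)) j -
      (u⁻¹ + v⁻¹) * jacksonTerm q u v (fun x => alSalamCarlitzWeight q u v x * x ^ (n + 1)) j +
      (1 - q ^ (n + 1)) * jacksonTerm q u v (fun x => alSalamCarlitzWeight q u v x * x ^ n) j =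
      jacksonTerm q u v (fun x => alSalamCarlitzWeight q u v x * x ^ n *
        ((u * v)⁻¹ * x ^ 2 - (u⁻¹ + v⁻¹) * x + (1 - q ^ (n + 1)))) j := by
    intro j
    simp only [jacksonTerm]
    ring
  simp only [e] at h
  have hlim : ∀ y : ℂ, Tendsto (fun n : ℕ => φ (y * q ^ n)) atTop (𝓝 0) := fun y => by
    have := (tendsto_qPochInf_div_mul_pow hq y u v).mul ((tendsto_mul_pow_zero hq y).pow (n + 1))
    simpa using this
  have key := tsum_jacksonTerm_of_sub (φ := φ) h.summable (fun x => by
    simp only [hφ]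
    rw [qPochInf_div_mul_qPochInf_div hq, mul_comm x q, ← alSalamCarlitzWeight, mul_pow]
    field_simp
    ring) (hlim u) (hlim v)
  rw [h.tsum_eq] at key
  simp only [hφ, div_self hu, div_self hv, qPochInf_one hq, mul_zero, zero_mul, sub_zero] at key
  change (u * v)⁻¹ * weightMoment q u v (n + 2) - (u⁻¹ + v⁻¹) * weightMoment q u v (n + 1) +
    (1 - q ^ (n + 1)) * weightMoment q u v n = 0 at key
  have h1 : u * v * (u * v)⁻¹ = 1 := mul_inv_cancel₀ (mul_ne_zero hu hv)
  have h2 : u * v * (u⁻¹ + v⁻¹) = u + v := by field_simp; ring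
  linear_combination u * v * key - weightMoment q u v (n + 2) * h1 +
    weightMoment q u v (n + 1) * h2

lemma weightMoment_eq (hq : ‖q‖ < 1) {u v : ℂ} (hu : u ≠ 0) (hv : v ≠ 0) (n : ℕ) :
    weightMoment q u v n = weightMoment q u v 0 * rogersSzego q n u v := by
  induction n using Nat.twoStepInduction with
  | zero => rw [rogersSzego_zero, mul_one]
  | one => rw [weightMoment_one hq hu hv, rogersSzego_one hq, mul_comm]
  | more n ih0 ih1 =>
    rw [weightMoment_add_two hq hu hv, rogersSzego_add_two hq, ih0, ih1]
    ring

/-- The total mass for `‖u‖ ≤ ‖v‖`: integrating the expansion of `1 / (qx/v; q)_∞` against the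
weight leaves `∫ (qx/u; q)_∞ d_q x`, whose series telescopes. -/
lemma weightMoment_zero_of_norm_le (hq : ‖q‖ < 1) {u v : ℂ} (hu : u ≠ 0) (hv : v ≠ 0)
    (huv : ‖u‖ ≤ ‖v‖) :
    weightMoment q u v 0 =
      (v - u) * qPochInf q q * qPochInf (q * u / v) q * qPochInf (q * v / u) q := by
  have hvq : q / v * v = q := div_mul_cancel₀ q hv
  have hv1 : ‖q / v * v‖ < 1 := by rwa [hvq]
  have hu1 : ‖q / v * u‖ < 1 := by
    refine lt_of_le_of_lt ?_ hv1
    rw [norm_mul, norm_mul]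
    gcongr
  have hsum : ∀ y : ℂ, ‖q / v * y‖ < 1 →
      Summable fun n => ‖(qPoch q q n)⁻¹ * (q / v) ^ n * y ^ n‖ := fun y hy => by
    simpa only [mul_pow, mul_assoc] using summable_norm_pow_div_qPoch hq hy
  have hnode : ∀ y : ℂ, ‖q / v * y‖ < 1 → ∀ j : ℕ, qPochInf (q * (y * q ^ j) / u) q =
      alSalamCarlitzWeight q u v (y * q ^ j) *
        ∑' n, (qPoch q q n)⁻¹ * (q / v) ^ n * (y * q ^ j) ^ n := by
    intro y hy j
    have h1 : ‖q * (y * q ^ j) / v‖ < 1 := by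
      rw [show q * (y * q ^ j) / v = q / v * y * q ^ j by ring]
      exact norm_mul_pow_lt_one hq hy j
    have h2 : ∑' n, (qPoch q q n)⁻¹ * (q / v) ^ n * (y * q ^ j) ^ n =
        (qPochInf (q * (y * q ^ j) / v) q)⁻¹ := by
      rw [← tsum_pow_div_qPoch hq h1]
      refine tsum_congr fun n => ?_
      rw [mul_assoc, ← mul_pow, div_mul_eq_mul_div]
    rw [h2, alSalamCarlitzWeight, mul_inv_cancel_right₀ (qPochInf_ne_zero hq h1)]
  obtain ⟨hs, ht⟩ := tsum_jacksonTerm_eq_tsum_moment hq (d := fun n => n)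
    (f := fun x => qPochInf (q * x / u) q) (hsum u hu1) (hsum v hv1) (hnode u hu1) (hnode v hv1)
  have hlim : ∀ y : ℂ, Tendsto (fun n : ℕ => -u * qPochInf (y * q ^ n / u) q) atTop
      (𝓝 (-u * 1)) := fun y => by
    refine ((tendsto_qPochInf_mul_pow hq (y / u)).const_mul (-u)).congr fun n => ?_
    rw [div_mul_eq_mul_div]
  have key := tsum_jacksonTerm_of_sub (φ := fun x => -u * qPochInf (x / u) q) hs (fun x => by
    rw [qPochInf_eq_one_sub_mul hq (x / u), div_mul_eq_mul_div, mul_comm x q]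
    field_simp
    ring) (hlim u) (hlim v)
  have hgen : ∑' n, (qPoch q q n)⁻¹ * (q / v) ^ n * weightMoment q u v n =
      weightMoment q u v 0 *
        ((qPochInf (q * u / v) q)⁻¹ * (qPochInf q q)⁻¹) := by
    have h1 := tsum_rogersSzegoDiv_mul_pow hq (a := u) (b := v) (x := q / v)
      (by rwa [mul_comm]) (by rwa [mul_comm])
    rw [show u * (q / v) = q * u / v by ring, mul_comm v, hvq] at h1
    rw [← h1, ← tsum_mul_left]
    refine tsum_congr fun n => ?_
    rw [weightMoment_eq hq hu hv n, rogersSzego]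
    have := qPoch_ne_zero hq hq n
    field_simp
  rw [hgen, key, div_self hu, qPochInf_one hq, qPochInf_eq_one_sub_mul hq (v / u),
    div_mul_eq_mul_div, mul_comm v q] at ht
  have h1 := qPochInf_ne_zero hq hq
  have h2 : qPochInf (q * u / v) q ≠ 0 :=
    qPochInf_ne_zero hq (by rwa [show q * u / v = q / v * u by ring])
  have h3 : -u * ((1 - v / u) * qPochInf (q * v / u) q) - -u * 0 =
      (v - u) * qPochInf (q * v / u) q := by
    field_simp
    ring
  rw [h3] at ht
  generalize qPochInf (q * u / v) q = A at *
  generalize qPochInf (q * v / u) q = B at *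
  field_simp at ht
  linear_combination -ht

lemma weightMoment_zero (hq : ‖q‖ < 1) {u v : ℂ} (hu : u ≠ 0) (hv : v ≠ 0) :
    weightMoment q u v 0 =
      v * (qPochInf q q * qPochInf (u / v) q * qPochInf (q * v / u) q) := by
  have h : weightMoment q u v 0 =
      (v - u) * qPochInf q q * qPochInf (q * u / v) q * qPochInf (q * v / u) q := by
    rcases le_total ‖u‖ ‖v‖ with huv | huv
    · exact weightMoment_zero_of_norm_le hq hu hv huv
    · rw [weightMoment_swap, weightMoment_zero_of_norm_le hq hv hu huv]
      ring
  rw [h, qPochInf_eq_one_sub_mul hq (u / v), div_mul_eq_mul_div, mul_comm u q]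
  field_simp

end Moments

/-! ### The integral -/

lemma norm_mul_mul_pow_lt_one {q a y : ℂ} (hq : ‖q‖ < 1) (h : ‖a * y‖ < 1) (j : ℕ) :
    ‖a * (y * q ^ j)‖ < 1 := by
  rw [← mul_assoc]
  exact norm_mul_pow_lt_one hq h j

lemma summable_norm_rogersSzegoDiv_mul_mul_pow {q a b c d y : ℂ} (hq : ‖q‖ < 1)
    (ha : ‖a * y‖ < 1) (hb : ‖b * y‖ < 1) (hc : ‖c * y‖ < 1) (hd : ‖d * y‖ < 1) :
    Summable fun p : ℕ × ℕ =>
      ‖rogersSzegoDiv q p.1 a b * rogersSzegoDiv q p.2 c d * y ^ (p.1 + p.2)‖ := by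
  refine ((summable_norm_rogersSzegoDiv_mul_pow hq ha hb).mul_norm
    (summable_norm_rogersSzegoDiv_mul_pow hq hc hd)).congr fun p => ?_
  rw [pow_add]
  ring_nf

lemma andrewsAskeyIntegrand_eq_tsum {q a b c d u v x : ℂ} (hq : ‖q‖ < 1)
    (ha : ‖a * x‖ < 1) (hb : ‖b * x‖ < 1) (hc : ‖c * x‖ < 1) (hd : ‖d * x‖ < 1) :
    andrewsAskeyIntegrand q a b c d u v x = alSalamCarlitzWeight q u v x *
      ∑' p : ℕ × ℕ, rogersSzegoDiv q p.1 a b * rogersSzegoDiv q p.2 c d * x ^ (p.1 + p.2) := by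
  have h := tsum_mul_tsum_of_summable_norm (summable_norm_rogersSzegoDiv_mul_pow hq ha hb)
    (summable_norm_rogersSzegoDiv_mul_pow hq hc hd)
  rw [tsum_rogersSzegoDiv_mul_pow hq ha hb, tsum_rogersSzegoDiv_mul_pow hq hc hd] at h
  have e : ∀ p : ℕ × ℕ,
      rogersSzegoDiv q p.1 a b * rogersSzegoDiv q p.2 c d * x ^ (p.1 + p.2) =
      rogersSzegoDiv q p.1 a b * x ^ p.1 * (rogersSzegoDiv q p.2 c d * x ^ p.2) := fun p => by
    rw [pow_add]
    ring
  simp only [e, ← h]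
  rw [andrewsAskeyIntegrand, alSalamCarlitzWeight, div_eq_mul_inv, mul_inv, mul_inv, mul_inv]
  ring

/-- An extension of the Andrews–Askey `q`-integral. Both series (the one defining the Jackson
integral and the one on the right-hand side) converge absolutely, and the identity holds. -/
theorem theorem7p2 (q : ℝ) (hq0 : 0 < q) (hq1 : q < 1) (a b c d u v : ℂ)
    (hu : u ≠ 0) (hv : v ≠ 0)
    (hau : ‖a * u‖ < 1) (hbu : ‖b * u‖ < 1) (hcu : ‖c * u‖ < 1) (hdu : ‖d * u‖ < 1)
    (hav : ‖a * v‖ < 1) (hbv : ‖b * v‖ < 1) (hcv : ‖c * v‖ < 1) (hdv : ‖d * v‖ < 1) :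
    Summable (jacksonTerm (q : ℂ) u v (andrewsAskeyIntegrand (q : ℂ) a b c d u v)) ∧
    Summable (andrewsAskeyTerm (q : ℂ) a b c d u v) ∧
    jacksonIntegral (q : ℂ) u v (andrewsAskeyIntegrand (q : ℂ) a b c d u v) =
      (1 - (q : ℂ)) * v *
        (qPochInf (q : ℂ) q * qPochInf (u / v) q * qPochInf ((q : ℂ) * v / u) q *
          qPochInf (a * b * u * v) q * qPochInf (c * d * u * v) q) /
        (qPochInf (a * u) q * qPochInf (b * u) q * qPochInf (c * u) q * qPochInf (d * u) q *
          (qPochInf (a * v) q * qPochInf (b * v) q * qPochInf (c * v) q * qPochInf (d * v) q)) *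
      ∑' k : ℕ, andrewsAskeyTerm (q : ℂ) a b c d u v k := by
  have hq : ‖(q : ℂ)‖ < 1 := by
    rwa [Complex.norm_real, Real.norm_of_nonneg hq0.le]
  obtain ⟨hs, ht⟩ := tsum_jacksonTerm_eq_tsum_moment hq (d := fun p : ℕ × ℕ => p.1 + p.2)
    (f := andrewsAskeyIntegrand q a b c d u v)
    (summable_norm_rogersSzegoDiv_mul_mul_pow hq hau hbu hcu hdu)
    (summable_norm_rogersSzegoDiv_mul_mul_pow hq hav hbv hcv hdv)
    (fun j => andrewsAskeyIntegrand_eq_tsum hq (norm_mul_mul_pow_lt_one hq hau j)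
      (norm_mul_mul_pow_lt_one hq hbu j) (norm_mul_mul_pow_lt_one hq hcu j)
      (norm_mul_mul_pow_lt_one hq hdu j))
    (fun j => andrewsAskeyIntegrand_eq_tsum hq (norm_mul_mul_pow_lt_one hq hav j)
      (norm_mul_mul_pow_lt_one hq hbv j) (norm_mul_mul_pow_lt_one hq hcv j)
      (norm_mul_mul_pow_lt_one hq hdv j))
  obtain ⟨C, hC1, hC⟩ := exists_norm_rogersSzegoDiv_le hq
  have hC0 : 0 ≤ C := zero_le_one.trans hC1
  -- the common growth rates `max ‖a‖ ‖b‖`, `max ‖c‖ ‖d‖` and `max ‖u‖ ‖v‖` have products below one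
  obtain ⟨hks, hk⟩ := hasSum_mul_rogersSzego_add hq (u := u) (v := v) hC0 hC0
    ((norm_nonneg a).trans (le_max_left _ _)) ((norm_nonneg c).trans (le_max_left _ _))
    (le_max_left _ _) (le_max_right _ _)
    (max_norm_mul_max_norm_lt_one hau hbu hav hbv) (max_norm_mul_max_norm_lt_one hcu hdu hcv hdv)
    (fun n => (hC n a b _ (le_max_left _ _) (le_max_right _ _)).2)
    (fun n => (hC n c d _ (le_max_left _ _) (le_max_right _ _)).2)
  have hab : ‖a * b * u * v‖ < 1 := by
    rw [show a * b * u * v = (a * u) * (b * v) by ring]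
    exact norm_mul_lt_one hau hbv
  have hcd : ‖c * d * u * v‖ < 1 := by
    rw [show c * d * u * v = (c * u) * (d * v) by ring]
    exact norm_mul_lt_one hcu hdv
  have nab := qPochInf_ne_zero hq hab
  have ncd := qPochInf_ne_zero hq hcd
  have nau := qPochInf_ne_zero hq hau
  have nbu := qPochInf_ne_zero hq hbu
  have ncu := qPochInf_ne_zero hq hcu
  have ndu := qPochInf_ne_zero hq hdu
  have nav := qPochInf_ne_zero hq hav
  have nbv := qPochInf_ne_zero hq hbv
  have ncv := qPochInf_ne_zero hq hcv
  have ndv := qPochInf_ne_zero hq hdv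
  set K : ℂ := qPochInf (a * b * u * v) q * qPochInf (c * d * u * v) q /
    (qPochInf (a * u) q * qPochInf (b * u) q * qPochInf (c * u) q * qPochInf (d * u) q *
      (qPochInf (a * v) q * qPochInf (b * v) q * qPochInf (c * v) q * qPochInf (d * v) q)) with hK
  have hK0 : K ≠ 0 := by
    rw [hK]
    positivity
  have hterm : ∀ k, eulerCoeff q (u * v) k *
      (shiftedPairing q u v (fun n => rogersSzego q n a b) k *
        shiftedPairing q u v (fun n => rogersSzego q n c d) k) =
      K * andrewsAskeyTerm q a b c d u v k := by
    intro k
    rw [shiftedPairing_rogersSzego hq hau hbu hav hbv, shiftedPairing_rogersSzego hq hcu hdu hcv hdv,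
      andrewsAskeyTerm, eulerCoeff, hK]
    simp only [div_eq_mul_inv, mul_inv]
    ring
  simp only [hterm] at hks hk
  refine ⟨hs, (summable_mul_left_iff hK0).mp hks, ?_⟩
  have hmom : ∀ p : ℕ × ℕ, rogersSzegoDiv q p.1 a b * rogersSzegoDiv q p.2 c d *
      weightMoment q u v (p.1 + p.2) = weightMoment q u v 0 *
        (((qPoch q q p.1)⁻¹ * rogersSzego q p.1 a b) * ((qPoch q q p.2)⁻¹ * rogersSzego q p.2 c d) *
          rogersSzego q (p.1 + p.2) u v) := by
    intro p
    rw [weightMoment_eq hq hu hv (p.1 + p.2), rogersSzego.eq_def q p.1, rogersSzego.eq_def q p.2,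
      inv_mul_cancel_left₀ (qPoch_ne_zero hq hq p.1), inv_mul_cancel_left₀ (qPoch_ne_zero hq hq p.2)]
    ring
  simp only [hmom] at ht
  rw [tsum_mul_left, hk.tsum_eq, tsum_mul_left, weightMoment_zero hq hu hv] at ht
  rw [jacksonIntegral, ht, hK]
  ring
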